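/- **Theorem.** Formulas of the logic $\mathsf{LHS}$ are given by $$\varphi ::= p^l_i \mid p^r_i \mid I \mid \neg\varphi \mid \varphi\wedge\varphi \mid \Box\varphi \mid \blacksquare\varphi \qquad (i\in\mathbb N),$$ where $\{p^l_i\}_{i\in\mathbb N}$ and $\{p^r_i\}_{i\in\mathbb N}$ are two disjoint countable sets of propositional variables. A model $M=(W,R,V)$ consists of a non-empty set $W$, a single binary relation $R\subseteq W\times W$, and a valuation $V$ assigning a subset of $W$ to every propositional variable. Truth at a pair of states $s,t\in W$ is defined by: $M,s,t\models p^l_i$ iff $s\in V(p^l_i)$; $M,s,t\models p^r_i$ iff $t\in V(p^r_i)$; $M,s,t\models I$ iff $s=t$; the usual clauses for $\neg,\wedge$; $M,s,t\models\Box\varphi$ iff $M,s',t\models\varphi$ for all $s'$ with $sRs'$; $M,s,t\models\blacksquare\varphi$ iff $M,s,t'\models\varphi$ for all $t'$ with $tRt'$. A formula $\varphi$ is satisfiable if $M,s,t\models\varphi$ for some model $M$ and some states $s,t$ of $M$. Then the satisfiability problem for $\mathsf{LHS}$ is undecidable: there is no algorithm that decides, given a formula $\varphi$, whether $\varphi$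 is satisfiable. Moreover, the $\mathbb N\times\mathbb N$ tiling problem reduces to it: there is a computable map $\mathbb T\mapsto\varphi_{\mathbb T}$ from finite sets of tile types (a tile type being given by the colors $\mathrm{up},\mathrm{down},\mathrm{left},\mathrm{right}\in\mathbb N$ of its four edges) to formulas such that $\varphi_{\mathbb T}$ is satisfiable if and only if $\mathbb T$ tiles $\mathbb N\times\mathbb N$, i.e. there is $g:\mathbb N\times\mathbb N\to\mathbb T$ with $\mathrm{right}(g(n,m))=\mathrm{left}(g(n+1,m))$ and $\mathrm{up}(g(n,m))=\mathrm{down}(g(n,m+1))$ for all $n,m\in\mathbb N$. -/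

import Mathlib

universe u

namespace LHS

/-- Formulas of the logic of hide and seek. The two disjoint countable families of propositional
variables are `pl i` and `pr i`, for `i : ℕ`; `box` is the white box (first evaluation state) and
`bbox` the black box (second evaluation state). -/
inductive Formula : Type
  | eqc : Formula
  | pl : ℕ → Formula
  | pr : ℕ → Formula
  | neg : Formula → Formula
  | and : Formula → Formula → Formula
  | box : Formula → Formula
  | bbox : Formula → Formula

/-- A model: a non-empty set of states, a single binary relation, and a valuation of both kinds of
propositional variables (`Sum.inl i` is the `i`-th left variable, `Sum.inr i` the `i`-th right
one). -/
structure Model where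
  W : Type u
  nonempty : Nonempty W
  R : W → W → Prop
  V : ℕ ⊕ ℕ → Set W

/-- Truth of a formula at a pair of states of a model. -/
def Holds (M : Model) : M.W → M.W → Formula → Prop
  | s, t, .eqc => s = t
  | s, _, .pl i => s ∈ M.V (Sum.inl i)
  | _, t, .pr i => t ∈ M.V (Sum.inr i)
  | s, t, .neg φ => ¬ Holds M s t φ
  | s, t, .and φ ψ => Holds M s t φ ∧ Holds M s t ψ
  | s, t, .box φ => ∀ s', M.R s s' → Holds M s' t φ
  | s, t, .bbox φ => ∀ t', M.R t t' → Holds M s t' φ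

/-- A formula is satisfiable if it is true at some pair of states of some model. -/
def Satisfiable (φ : Formula) : Prop :=
  ∃ (M : Model.{u}) (s t : M.W), Holds M s t φ

/-! ### Gödel numbering of formulas -/

/-- The Gödel number of a formula. -/
def Formula.toNat : Formula → ℕ
  | .eqc => 0
  | .pl i => 6 * i + 1
  | .pr i => 6 * i + 2
  | .neg φ => 6 * φ.toNat + 3
  | .and φ ψ => 6 * Nat.pair φ.toNat ψ.toNat + 4
  | .box φ => 6 * φ.toNat + 5
  | .bbox φ => 6 * φ.toNat + 6

/-- The formula with a given Gödel number. -/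
def Formula.ofNat : ℕ → Formula
  | 0 => .eqc
  | n + 1 =>
    have h : n / 6 ≤ n := Nat.div_le_self n 6
    have _h₁ : (n / 6).unpair.1 ≤ n := (Nat.unpair_left_le _).trans h
    have _h₂ : (n / 6).unpair.2 ≤ n := (Nat.unpair_right_le _).trans h
    match n % 6 with
    | 0 => .pl (n / 6)
    | 1 => .pr (n / 6)
    | 2 => .neg (Formula.ofNat (n / 6))
    | 3 => .and (Formula.ofNat (n / 6).unpair.1) (Formula.ofNat (n / 6).unpair.2)
    | 4 => .box (Formula.ofNat (n / 6))
    | _ => .bbox (Formula.ofNat (n / 6))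

theorem Formula.ofNat_toNat (φ : Formula) : Formula.ofNat φ.toNat = φ := by
  have hd : ∀ m k : ℕ, k < 6 → (6 * m + k) / 6 = m ∧ (6 * m + k) % 6 = k := by omega
  induction φ with
  | eqc => simp [Formula.toNat, Formula.ofNat]
  | pl i => simp [Formula.toNat, Formula.ofNat]
  | pr i =>
    have h := hd i 1 (by omega)
    simp [Formula.toNat, Formula.ofNat, h]
  | neg φ ih =>
    have h := hd φ.toNat 2 (by omega)
    simp [Formula.toNat, Formula.ofNat, h, ih]
  | and φ ψ ih₁ ih₂ =>
    have h := hd (Nat.pair φ.toNat ψ.toNat) 3 (by omega)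
    simp [Formula.toNat, Formula.ofNat, h, ih₁, ih₂]
  | box φ ih =>
    have h := hd φ.toNat 4 (by omega)
    simp [Formula.toNat, Formula.ofNat, h, ih]
  | bbox φ ih =>
    have h := hd φ.toNat 5 (by omega)
    simp [Formula.toNat, Formula.ofNat, h, ih]

theorem Formula.toNat_ofNat (n : ℕ) : (Formula.ofNat n).toNat = n := by
  induction n using Nat.strong_induction_on with
  | _ n ih =>
    cases n with
    | zero => simp [Formula.toNat, Formula.ofNat]
    | succ n =>
      have h : n / 6 ≤ n := Nat.div_le_self n 6
      have i₀ := ih (n / 6) (by omega)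
      have i₁ := ih (n / 6).unpair.1 (by have := Nat.unpair_left_le (n / 6); omega)
      have i₂ := ih (n / 6).unpair.2 (by have := Nat.unpair_right_le (n / 6); omega)
      have hm : n % 6 = 0 ∨ n % 6 = 1 ∨ n % 6 = 2 ∨ n % 6 = 3 ∨ n % 6 = 4 ∨ n % 6 = 5 := by omega
      rw [Formula.ofNat]
      rcases hm with hm | hm | hm | hm | hm | hm <;>
        simp only [hm, Formula.toNat, i₀, i₁, i₂, Nat.pair_unpair] <;> omega

/-- The Gödel numbering is a bijection between formulas and natural numbers. -/
def Formula.equivNat : Formula ≃ ℕ where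
  toFun := Formula.toNat
  invFun := Formula.ofNat
  left_inv := Formula.ofNat_toNat
  right_inv := Formula.toNat_ofNat

/-- Computability on formulas is computability on their Gödel numbers. -/
instance : Primcodable Formula := Primcodable.ofEquiv ℕ Formula.equivNat

/-! ### The tiling problem -/

/-- A tile type, given by the colors of its up, down, left and right edges. -/
abbrev Tile : Type := ℕ × ℕ × ℕ × ℕ

def Tile.up (T : Tile) : ℕ := T.1

def Tile.down (T : Tile) : ℕ := T.2.1

def Tile.left (T : Tile) : ℕ := T.2.2.1

def Tile.right (T : Tile) : ℕ := T.2.2.2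

/-- A finite list of tile types tiles `ℕ × ℕ` if the quadrant can be covered by copies of these
tiles such that adjacent edges have the same color. -/
def TilesQuadrant (𝕋 : List Tile) : Prop :=
  ∃ g : ℕ × ℕ → Tile, (∀ x, g x ∈ 𝕋) ∧
    ∀ n m : ℕ, Tile.right (g (n, m)) = Tile.left (g (n + 1, m)) ∧
      Tile.up (g (n, m)) = Tile.down (g (n, m + 1))

end LHS

/-!
Two reductions are composed. In the first, the single relation of a model is made to carry any
number of relations: the elements of a multi-relational structure are the successors of a root,
and a `k`-edge from `x` to `y` is an intermediate state labelled `k` between them. Left and right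
variables can be made to agree on the intermediate states, because a formula evaluated at a pair
`(e, e)` sees the same state through both of its components. So satisfiability of a
multi-relational formula under a global assumption reduces to satisfiability in `LHS`.

In the second, a global assumption describes a computation. For tilings it says that two serial
relations commute and carry a matching assignment of tiles. For the halting problem, the elements
stand for lists of natural numbers and each subprogram of a fixed program has a relation, which
the assumption forces to contain the graph of the partial function computed by the subprogram.
The assumption holds when the relations are these graphs, so it is consistent with the program
diverging on a given input if and only if the program does diverge.
-/

universe v w z

open Encodable (encode)

namespace LHS

/-! ### The multi-relational logic -/

/-- Formulas of the logic of hide and seek with one pair of boxes for each relation symbol in `σ`.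
Only the first evaluation state has propositional variables, which are the elements of `π`. -/
inductive MultiFormula (σ : Type v) (π : Type w) : Type (max v w)
  | eq : MultiFormula σ π
  | prop : π → MultiFormula σ π
  | neg : MultiFormula σ π → MultiFormula σ π
  | and : MultiFormula σ π → MultiFormula σ π → MultiFormula σ π
  | boxL : σ → MultiFormula σ π → MultiFormula σ π
  | boxR : σ → MultiFormula σ π → MultiFormula σ π

namespace MultiFormula

variable {σ : Type v} {π : Type w}

/-- Implication, encoded by negation and conjunction. -/
def imp (φ ψ : MultiFormula σ π) : MultiFormula σ π := .neg (.and φ (.neg ψ))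

/-- The true formula, encoded by the tautology `eq → eq`. -/
def top : MultiFormula σ π := imp .eq .eq

/-- The possibility operator dual to `boxL`. -/
def diaL (k : σ) (φ : MultiFormula σ π) : MultiFormula σ π := .neg (.boxL k (.neg φ))

/-- The possibility operator dual to `boxR`. -/
def diaR (k : σ) (φ : MultiFormula σ π) : MultiFormula σ π := .neg (.boxR k (.neg φ))

/-- Conjunction over a list, with `top` for the empty list. -/
def bigAnd {B : Type*} (l : List B) (φ : B → MultiFormula σ π) : MultiFormula σ π :=
  l.foldr (fun b ψ => .and (φ b) ψ) top

/-- Disjunction over a list, the de Morgan dual of `bigAnd`. -/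
def bigOr {B : Type*} (l : List B) (φ : B → MultiFormula σ π) : MultiFormula σ π :=
  .neg (bigAnd l fun b => .neg (φ b))

/-- The relation symbols `k` whose right box `boxR k` occurs in a formula. -/
def rightSymbols : MultiFormula σ π → List σ
  | .eq => []
  | .prop _ => []
  | .neg φ => φ.rightSymbols
  | .and φ ψ => φ.rightSymbols ++ ψ.rightSymbols
  | .boxL _ φ => φ.rightSymbols
  | .boxR k φ => k :: φ.rightSymbols

end MultiFormula

/-- A structure on `D` for the relation symbols in `σ` and the propositional variables in `π`. -/
structure MultiModel (σ : Type v) (π : Type w) (D : Type*) where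
  rel : σ → D → D → Prop
  pred : π → D → Prop

namespace MultiModel

open MultiFormula

variable {σ : Type v} {π : Type w} {D : Type*} (S : MultiModel σ π D) {x y : D}
  {φ ψ : MultiFormula σ π} {k : σ}

/-- Truth of a multi-relational formula at a pair of elements. -/
@[simp]
def Holds : D → D → MultiFormula σ π → Prop
  | x, y, .eq => x = y
  | x, _, .prop p => S.pred p x
  | x, y, .neg φ => ¬ Holds x y φ
  | x, y, .and φ ψ => Holds x y φ ∧ Holds x y ψ
  | x, y, .boxL k φ => ∀ x₁, S.rel k x x₁ → Holds x₁ y φ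
  | x, y, .boxR k φ => ∀ y₁, S.rel k y y₁ → Holds x y₁ φ

/-- Truth at all diagonal pairs, the sense in which a formula is a global assumption. -/
def Valid (φ : MultiFormula σ π) : Prop := ∀ x, S.Holds x x φ

@[simp]
theorem holds_imp : S.Holds x y (imp φ ψ) ↔ (S.Holds x y φ → S.Holds x y ψ) := by simp [imp]

@[simp]
theorem holds_top : S.Holds x y top := by simp [top]

@[simp]
theorem holds_diaL : S.Holds x y (diaL k φ) ↔ ∃ x', S.rel k x x' ∧ S.Holds x' y φ := by
  simp [diaL]

@[simp]
theorem holds_diaR : S.Holds x y (diaR k φ) ↔ ∃ y', S.rel k y y' ∧ S.Holds x y' φ := by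
  simp [diaR]

@[simp]
theorem holds_bigAnd {B : Type*} {l : List B} {φ : B → MultiFormula σ π} :
    S.Holds x y (bigAnd l φ) ↔ ∀ b ∈ l, S.Holds x y (φ b) := by
  induction l with
  | nil => simp [bigAnd]
  | cons b l ih => simpa [bigAnd] using fun _ => ih

@[simp]
theorem holds_bigOr {B : Type*} {l : List B} {φ : B → MultiFormula σ π} :
    S.Holds x y (bigOr l φ) ↔ ∃ b ∈ l, S.Holds x y (φ b) := by
  simp [bigOr]

@[simp]
theorem valid_and : S.Valid (.and φ ψ) ↔ S.Valid φ ∧ S.Valid ψ := forall_and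

end MultiModel

/-! ### Coding many relations by one -/

section Holds

variable {M : Model.{u}} {r s t : M.W} {φ ψ : Formula}

/-- Implication, encoded by negation and conjunction. -/
def Formula.imp (φ ψ : Formula) : Formula := .neg (.and φ (.neg ψ))

theorem holds_imp : Holds M s t (.imp φ ψ) ↔ (Holds M s t φ → Holds M s t ψ) := by
  simp [Formula.imp, Holds]

/-- At a diagonal pair `(s, s)`: the formula `φ` holds at `(s', s')` for all successors `s'`
of `s`. -/
def Formula.everywhere (φ : Formula) : Formula := .box (.bbox (.imp .eqc φ))

theorem holds_everywhere :
    Holds M s s (.everywhere φ) ↔ ∀ s', M.R s s' → Holds M s' s' φ := by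
  simp only [Formula.everywhere, Holds, holds_imp]
  exact ⟨fun h x hx => h x hx x hx rfl, fun h x hx y _ hxy => hxy ▸ h x hx⟩

/-- At a diagonal pair `(r, r)`: all states reached from `r` in three steps are successors
of `r`. -/
def Formula.threeStepClosed : Formula := .box (.box (.box (.neg (.bbox (.neg .eqc)))))

theorem holds_threeStepClosed :
    Holds M r r .threeStepClosed ↔ ∀ x, M.R r x → ∀ e, M.R x e → ∀ y, M.R e y → M.R r y := by
  simp [Formula.threeStepClosed, Holds]

/-- At a diagonal pair `(r, r)`: the `i`-th left and right variables agree at all states reached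
from `r` in two steps. -/
def Formula.labelsAgree (i : ℕ) : Formula :=
  .everywhere (.everywhere (.and (.imp (.pl i) (.pr i)) (.imp (.pr i) (.pl i))))

theorem holds_labelsAgree {i : ℕ} :
    Holds M r r (.labelsAgree i) ↔
      ∀ x, M.R r x → ∀ e, M.R x e → (e ∈ M.V (.inl i) ↔ e ∈ M.V (.inr i)) := by
  simp only [Formula.labelsAgree, holds_everywhere, Holds, holds_imp, iff_def]

end Holds

/-- A two-step transition whose intermediate state carries the variable `j`. -/
def Model.StepVia (M : Model.{u}) (j : ℕ ⊕ ℕ) (s s' : M.W) : Prop :=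
  ∃ e, M.R s e ∧ e ∈ M.V j ∧ M.R e s'

section Coding

variable {σ : Type v} {π : Type w} [Encodable σ] [Encodable π]

/-- Relation symbols become two-step transitions through a state labelled by the symbol. -/
def MultiFormula.toFormula : MultiFormula σ π → Formula
  | .eq => .eqc
  | .prop p => .pl (encode p)
  | .neg φ => .neg φ.toFormula
  | .and φ ψ => .and φ.toFormula ψ.toFormula
  | .boxL k φ => .box (.imp (.pl (encode k)) (.box φ.toFormula))
  | .boxR k φ => .bbox (.imp (.pr (encode k)) (.bbox φ.toFormula))

section Holds

variable {M : Model.{u}} {s t : M.W} {k : σ} {φ : MultiFormula σ π}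

theorem holds_toFormula_boxL :
    Holds M s t (MultiFormula.boxL k φ).toFormula ↔
      ∀ s', M.StepVia (.inl (encode k)) s s' → Holds M s' t φ.toFormula := by
  simp only [MultiFormula.toFormula, Holds, holds_imp, Model.StepVia]
  grind

theorem holds_toFormula_boxR :
    Holds M s t (MultiFormula.boxR k φ).toFormula ↔
      ∀ t', M.StepVia (.inr (encode k)) t t' → Holds M s t' φ.toFormula := by
  simp only [MultiFormula.toFormula, Holds, holds_imp, Model.StepVia]
  grind

end Holds

/-- The structure `S` is coded in the model `M` along the map `ι`. The coding is symmetric in left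
and right only for the relation symbols in `K`. -/
structure IsCoding (M : Model.{u}) {D : Type*} (S : MultiModel σ π D) (K : Set σ) (ι : D → M.W) :
    Prop where
  injective : Function.Injective ι
  left_iff : ∀ k x s, M.StepVia (.inl (encode k)) (ι x) s ↔ ∃ y, S.rel k x y ∧ ι y = s
  right_iff : ∀ k ∈ K, ∀ x s, M.StepVia (.inr (encode k)) (ι x) s ↔ ∃ y, S.rel k x y ∧ ι y = s
  prop_iff : ∀ p x, ι x ∈ M.V (.inl (encode p)) ↔ S.pred p x

theorem IsCoding.holds_toFormula {M : Model.{u}} {D : Type*} {S : MultiModel σ π D} {K : Set σ}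
    {ι : D → M.W} (h : IsCoding M S K ι) {φ : MultiFormula σ π}
    (hφ : ∀ k ∈ φ.rightSymbols, k ∈ K) {x y : D} :
    Holds M (ι x) (ι y) φ.toFormula ↔ S.Holds x y φ := by
  induction φ generalizing x y with
  | eq => exact h.injective.eq_iff
  | prop p => exact h.prop_iff p x
  | neg φ ih => exact not_congr (ih hφ)
  | and φ ψ ihφ ihψ =>
    simp only [MultiFormula.rightSymbols, List.mem_append, or_imp, forall_and] at hφ
    exact and_congr (ihφ hφ.1) (ihψ hφ.2)
  | boxL k φ ih => simp [holds_toFormula_boxL, h.left_iff, ih hφ]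
  | boxR k φ ih =>
    simp only [MultiFormula.rightSymbols, List.forall_mem_cons] at hφ
    simp [holds_toFormula_boxR, h.right_iff k hφ.1, ih hφ.2]

/-- For right boxes over `K` only: `α` is true everywhere on the diagonal and `β` somewhere on it,
in some structure for the symbols in `σ` and `π`. -/
def codingFormula (K : List σ) (α β : MultiFormula σ π) : Formula :=
  .and (K.foldr (fun k φ => .and (.labelsAgree (encode k)) φ) .eqc)
    (.and .threeStepClosed
      (.and (.everywhere α.toFormula) (.neg (.everywhere (.neg β.toFormula)))))

theorem holds_codingFormula {M : Model.{u}} {r t : M.W} {K : List σ} {α β : MultiFormula σ π} :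
    Holds M r t (codingFormula K α β) ↔ r = t ∧
      (∀ k ∈ K, ∀ x, M.R r x → ∀ e, M.R x e →
        (e ∈ M.V (.inl (encode k)) ↔ e ∈ M.V (.inr (encode k)))) ∧
      (∀ x, M.R r x → ∀ e, M.R x e → ∀ y, M.R e y → M.R r y) ∧
      (∀ x, M.R r x → Holds M x x α.toFormula) ∧ ∃ x, M.R r x ∧ Holds M x x β.toFormula := by
  have holds_foldr : Holds M r t (K.foldr (fun k φ => .and (.labelsAgree (encode k)) φ) .eqc) ↔
      r = t ∧ ∀ k ∈ K, Holds M r t (.labelsAgree (encode k)) := by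
    induction K with
    | nil => simp [Holds]
    | cons k K ih => simp [Holds, ih, and_left_comm]
  rcases eq_or_ne r t with rfl | hne
  · simp [codingFormula, Holds, holds_foldr, holds_labelsAgree, holds_threeStepClosed,
      holds_everywhere]
  · simp [codingFormula, Holds, holds_foldr, hne]

/-- The structure read off from the successors of a state. -/
def Model.successorModel (M : Model.{u}) (r : M.W) : MultiModel σ π {x // M.R r x} where
  rel k x y := M.StepVia (.inl (encode k)) x y
  pred p x := x.1 ∈ M.V (.inl (encode p))

theorem isCoding_successorModel {M : Model.{u}} {r : M.W} {K : Set σ}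
    (agree : ∀ k ∈ K, ∀ x, M.R r x → ∀ e, M.R x e →
      (e ∈ M.V (.inl (encode k)) ↔ e ∈ M.V (.inr (encode k))))
    (closed : ∀ x, M.R r x → ∀ e, M.R x e → ∀ y, M.R e y → M.R r y) :
    IsCoding M (M.successorModel r : MultiModel σ π _) K Subtype.val := by
  have left_iff (k : σ) (x : {x // M.R r x}) (s : M.W) :
      M.StepVia (.inl (encode k)) x.1 s ↔
        ∃ y, (M.successorModel r : MultiModel σ π _).rel k x y ∧ y.1 = s := by
    refine ⟨fun h => ?_, fun ⟨_, hy, hys⟩ => hys ▸ hy⟩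
    obtain ⟨e, hxe, -, hes⟩ := id h
    exact ⟨⟨s, closed x x.2 e hxe s hes⟩, h, rfl⟩
  refine ⟨Subtype.val_injective, left_iff, fun k hk x s => ?_, fun _ _ => Iff.rfl⟩
  rw [← left_iff]
  exact exists_congr fun e => and_congr_right fun hxe =>
    and_congr_left fun _ => (agree k hk x x.2 e hxe).symm

theorem exists_multiModel_of_satisfiable {K : List σ} {α β : MultiFormula σ π}
    (hα : α.rightSymbols ⊆ K) (hβ : β.rightSymbols ⊆ K)
    (h : Satisfiable.{u} (codingFormula K α β)) :
    ∃ (D : Type u) (S : MultiModel σ π D), S.Valid α ∧ ∃ x, S.Holds x x β := by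
  obtain ⟨M, r, t, h⟩ := h
  obtain ⟨-, agree, closed, validα, x, hx, holdsβ⟩ := holds_codingFormula.1 h
  have coding := isCoding_successorModel (π := π) (K := {k | k ∈ K}) agree closed
  exact ⟨_, M.successorModel r, fun y => (coding.holds_toFormula hα).1 (validα y y.2),
    ⟨x, hx⟩, (coding.holds_toFormula hβ).1 holdsβ⟩

/-- The states of the model coding a structure on `D`: a root, the elements of `D`, and for each
relation symbol and each target an intermediate state shared by the edges with this symbol and
target. -/
inductive CodingState (σ : Type v) (D : Type z) : Type (max u v z)
  | root : CodingState σ D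
  | elt : D → CodingState σ D
  | edge : σ → D → CodingState σ D

namespace MultiModel

variable {D : Type z} (S : MultiModel σ π D)

/-- The accessibility relation of the model coding `S`. -/
inductive CodingRel : CodingState σ D → CodingState σ D → Prop
  | root_elt (x : D) : CodingRel .root (.elt x)
  | elt_edge {k : σ} {x y : D} : S.rel k x y → CodingRel (.elt x) (.edge k y)
  | edge_elt (k : σ) (y : D) : CodingRel (.edge k y) (.elt y)

/-- The state satisfies the `i`-th left and right variables. Elements and edges may share these
without conflict. -/
def CodingLabel (i : ℕ) : CodingState σ D → Prop
  | .root => False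
  | .elt x => ∃ p, encode p = i ∧ S.pred p x
  | .edge k _ => encode k = i

/-- The single-relation model in which `S` is coded. -/
def codingModel : Model.{max u v z} where
  W := CodingState.{u} σ D
  nonempty := ⟨.root⟩
  R := S.CodingRel
  V j := {s | S.CodingLabel (j.elim id id) s}

theorem isCoding_codingModel : IsCoding (codingModel.{u} S) S Set.univ .elt := by
  have stepVia_iff {j : ℕ ⊕ ℕ} {k : σ} (hj : j.elim id id = encode k) (x : D)
      (s : CodingState.{u} σ D) :
      (codingModel.{u} S).StepVia j (.elt x) s ↔ ∃ y, S.rel k x y ∧ .elt y = s := by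
    constructor
    · rintro ⟨_, ⟨⟩ | @⟨k', _, y, hxy⟩, hk, ⟨⟩⟩
      obtain rfl : k' = k := Encodable.encode_injective (hk.trans hj)
      exact ⟨y, hxy, rfl⟩
    · rintro ⟨y, hxy, rfl⟩
      exact ⟨.edge k y, .elt_edge hxy, hj.symm, .edge_elt k y⟩
  refine ⟨fun _ _ => CodingState.elt.inj, fun k => stepVia_iff rfl, fun k _ => stepVia_iff rfl,
    fun p x => ⟨?_, fun h => ⟨p, rfl, h⟩⟩⟩
  rintro ⟨p', hp', h⟩
  exact Encodable.encode_injective hp' ▸ h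

end MultiModel

open MultiModel in
theorem satisfiable_codingFormula {D : Type z} (S : MultiModel σ π D) {K : List σ}
    {α β : MultiFormula σ π} (hα : S.Valid α) (hβ : ∃ x, S.Holds x x β) :
    Satisfiable.{max u v z} (codingFormula K α β) := by
  have coding := isCoding_codingModel.{u} S
  obtain ⟨x, hx⟩ := hβ
  refine ⟨codingModel.{u} S, .root, .root, holds_codingFormula.2 ⟨rfl, fun _ _ _ _ _ _ => Iff.rfl,
    ?_, ?_, .elt x, .root_elt x, (coding.holds_toFormula fun _ _ => trivial).2 hx⟩⟩
  · rintro _ ⟨⟩ _ ⟨⟩ _ ⟨⟩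
    exact .root_elt _
  · rintro _ ⟨⟩
    exact (coding.holds_toFormula fun _ _ => trivial).2 (hα _)

end Coding

/-! ### Computability of the translation -/

section Computability

open Primrec

variable {A : Type*} [Primcodable A]

theorem primrec_iff_toNat {f : A → Formula} : Primrec f ↔ Primrec fun a => (f a).toNat :=
  (Primrec.of_equiv_iff Formula.equivNat).symm

theorem primrec_toNat : Primrec Formula.toNat := Primrec.of_equiv (e := Formula.equivNat)

theorem primrec_six_mul_add (k : ℕ) {f : A → ℕ} (hf : Primrec f) :
    Primrec fun a => 6 * f a + k :=
  nat_add.comp (nat_mul.comp (.const 6) hf) (.const k)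

theorem primrec_pl {f : A → ℕ} (hf : Primrec f) : Primrec fun a => Formula.pl (f a) :=
  primrec_iff_toNat.2 (primrec_six_mul_add 1 hf)

section Connectives

variable {f g : A → Formula}

theorem primrec_neg (hf : Primrec f) : Primrec fun a => Formula.neg (f a) :=
  primrec_iff_toNat.2 (primrec_six_mul_add 3 (primrec_toNat.comp hf))

theorem primrec_and (hf : Primrec f) (hg : Primrec g) : Primrec fun a => Formula.and (f a) (g a) :=
  primrec_iff_toNat.2 (primrec_six_mul_add 4
    (Primrec₂.natPair.comp (primrec_toNat.comp hf) (primrec_toNat.comp hg)))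

theorem primrec_box (hf : Primrec f) : Primrec fun a => Formula.box (f a) :=
  primrec_iff_toNat.2 (primrec_six_mul_add 5 (primrec_toNat.comp hf))

theorem primrec_bbox (hf : Primrec f) : Primrec fun a => Formula.bbox (f a) :=
  primrec_iff_toNat.2 (primrec_six_mul_add 6 (primrec_toNat.comp hf))

theorem primrec_imp (hf : Primrec f) (hg : Primrec g) : Primrec fun a => Formula.imp (f a) (g a) :=
  primrec_neg (primrec_and hf (primrec_neg hg))

theorem primrec_everywhere (hf : Primrec f) : Primrec fun a => Formula.everywhere (f a) :=
  primrec_box (primrec_bbox (primrec_imp (.const _) hf))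

end Connectives

variable {σ : Type v} [Encodable σ]

theorem primrec_toFormula_prop {π : Type w} [Primcodable π] {p : A → π} (hp : Primrec p) :
    Primrec fun a => (MultiFormula.prop (p a) : MultiFormula σ π).toFormula :=
  primrec_pl (Primrec.encode.comp hp)

variable {π : Type w} [Encodable π] {f g : A → MultiFormula σ π}

theorem primrec_toFormula_boxL (k : σ) (hf : Primrec fun a => (f a).toFormula) :
    Primrec fun a => (MultiFormula.boxL k (f a)).toFormula :=
  primrec_box (primrec_imp (.const _) (primrec_box hf))

theorem primrec_toFormula_diaL (k : σ) (hf : Primrec fun a => (f a).toFormula) :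
    Primrec fun a => (MultiFormula.diaL k (f a)).toFormula :=
  primrec_neg (primrec_toFormula_boxL k (f := fun a => .neg (f a)) (primrec_neg hf))

section Lists

variable {B : Type*} [Primcodable B] {l : A → List B} {F : A → B → MultiFormula σ π}

theorem primrec_toFormula_bigAnd (hl : Primrec l) (hF : Primrec₂ fun a b => (F a b).toFormula) :
    Primrec fun a => (MultiFormula.bigAnd (l a) (F a)).toFormula := by
  have foldr_eq (a : A) (l : List B) :
      l.foldr (fun b ψ => .and (F a b).toFormula ψ) (MultiFormula.top (σ := σ) (π := π)).toFormula =
        (MultiFormula.bigAnd l (F a)).toFormula := by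
    induction l with
    | nil => rfl
    | cons b l ih => exact congrArg (Formula.and (F a b).toFormula) ih
  exact (Primrec.list_foldr hl (.const _) (primrec_and
    (hF.comp fst (fst.comp snd)) (snd.comp snd)).to₂).of_eq fun a => foldr_eq a (l a)

theorem primrec_toFormula_bigOr (hl : Primrec l) (hF : Primrec₂ fun a b => (F a b).toFormula) :
    Primrec fun a => (MultiFormula.bigOr (l a) (F a)).toFormula :=
  primrec_neg (primrec_toFormula_bigAnd hl (F := fun a b => .neg (F a b)) (primrec_neg hF))

end Lists

theorem primrec_codingFormula (K : List σ) (hf : Primrec fun a => (f a).toFormula)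
    (hg : Primrec fun a => (g a).toFormula) : Primrec fun a => codingFormula K (f a) (g a) :=
  primrec_and (.const _) (primrec_and (.const _)
    (primrec_and (primrec_everywhere hf)
      (primrec_neg (primrec_everywhere (primrec_neg hg)))))

end Computability

/-! ### Tilings -/

/-- The relation symbols of the grid. -/
inductive Direction
  | right
  | up

noncomputable instance : Encodable Direction :=
  .ofInj (fun d => d matches .right) (by rintro ⟨⟩ ⟨⟩ <;> simp)

namespace MultiFormula

/-- No edge in the direction `k` leads from `T` to `U`. -/
def noEdge (k : Direction) (T U : Tile) : MultiFormula Direction Tile :=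
  imp (.prop T) (.boxL k (.neg (.prop U)))

/-- The tiles `T` and `U` are not adjacent unless their colors match. -/
def tilesMatch (T U : Tile) : MultiFormula Direction Tile :=
  .and (if Tile.right T = Tile.left U then top else noEdge .right T U)
    (if Tile.up T = Tile.down U then top else noEdge .up T U)

/-- The two relations of the grid are serial and commute. -/
def grid : MultiFormula Direction Tile :=
  .and (diaL .right top) (.and (diaL .up top)
    (.boxL .right (.boxL .up (.boxR .up (.boxR .right .eq)))))

/-- The assumption describing the grids tiled by the tiles in `l`. -/
def tiledGrid (l : List Tile) : MultiFormula Direction Tile :=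
  .and grid (.and (bigOr l .prop) (bigAnd l fun T => bigAnd l (tilesMatch T)))

end MultiFormula

open MultiFormula

/-- The semantic content of `tiledGrid l`. An element may carry several tiles, all of which match
those of its neighbours. -/
structure IsTiledGrid {D : Type*} (S : MultiModel Direction Tile D) (l : List Tile) : Prop where
  exists_right : ∀ x, ∃ y, S.rel .right x y
  exists_up : ∀ x, ∃ y, S.rel .up x y
  commute : ∀ ⦃x y z y' z'⦄, S.rel .right x y → S.rel .up y z → S.rel .up x y' →
    S.rel .right y' z' → z = z'
  exists_tile : ∀ x, ∃ T ∈ l, S.pred T x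
  right_match : ∀ ⦃x y⦄, S.rel .right x y → ∀ T ∈ l, ∀ T' ∈ l, S.pred T x → S.pred T' y →
    Tile.right T = Tile.left T'
  up_match : ∀ ⦃x y⦄, S.rel .up x y → ∀ T ∈ l, ∀ T' ∈ l, S.pred T x → S.pred T' y →
    Tile.up T = Tile.down T'

section

variable {D : Type*} {S : MultiModel Direction Tile D} {l : List Tile}

theorem holds_tilesMatch {x y : D} {T T' : Tile} :
    S.Holds x y (tilesMatch T T') ↔
      (S.pred T x → ∀ y, S.rel .right x y → S.pred T' y → Tile.right T = Tile.left T') ∧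
        (S.pred T x → ∀ y, S.rel .up x y → S.pred T' y → Tile.up T = Tile.down T') := by
  rw [tilesMatch]
  refine and_congr ?_ ?_ <;> split_ifs with h <;> simp [noEdge, h]

theorem valid_tiledGrid_iff : S.Valid (tiledGrid l) ↔ IsTiledGrid S l := by
  simp only [tiledGrid, grid, MultiModel.valid_and]
  simp only [MultiModel.Valid, MultiModel.holds_diaL, MultiModel.holds_top, and_true,
    MultiModel.holds_bigOr, MultiModel.holds_bigAnd, MultiModel.Holds, holds_tilesMatch]
  constructor
  · rintro ⟨⟨hr, hu, hc⟩, ht, hm⟩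
    exact ⟨hr, hu, fun x y z y' z' hy hz hy' hz' => hc x y hy z hz y' hy' z' hz', ht,
      fun x y hxy T hT T' hT' hx hy => (hm x T hT T' hT').1 hx y hxy hy,
      fun x y hxy T hT T' hT' hx hy => (hm x T hT T' hT').2 hx y hxy hy⟩
  · intro h
    exact ⟨⟨h.exists_right, h.exists_up, fun x y hy z hz y' hy' z' hz' =>
        h.commute hy hz hy' hz'⟩, h.exists_tile, fun x T hT T' hT' =>
        ⟨fun hx y hxy => h.right_match hxy T hT T' hT' hx,
          fun hx y hxy => h.up_match hxy T hT T' hT' hx⟩⟩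

theorem IsTiledGrid.tilesQuadrant (h : IsTiledGrid S l) (x₀ : D) : TilesQuadrant l := by
  choose H rel_H using h.exists_right
  choose V rel_V using h.exists_up
  choose T T_mem pred_T using h.exists_tile
  have comm : Function.Commute V H := fun x =>
    h.commute (rel_H x) (rel_V _) (rel_V x) (rel_H _)
  refine ⟨fun p => T (H^[p.1] (V^[p.2] x₀)), fun _ => T_mem _, fun n m => ⟨?_, ?_⟩⟩
  · simp only [Function.iterate_succ_apply']
    exact h.right_match (rel_H _) _ (T_mem _) _ (T_mem _) (pred_T _) (pred_T _)
  · simp only [Function.iterate_succ_apply', ← (comm.iterate_right n).eq]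
    exact h.up_match (rel_V _) _ (T_mem _) _ (T_mem _) (pred_T _) (pred_T _)

end

/-- The quadrant with the tiling `g`. -/
def quadrantModel (g : ℕ × ℕ → Tile) : MultiModel Direction Tile (ℕ × ℕ) where
  rel
    | .right, x, y => y = (x.1 + 1, x.2)
    | .up, x, y => y = (x.1, x.2 + 1)
  pred T x := g x = T

theorem isTiledGrid_quadrantModel {g : ℕ × ℕ → Tile} {l : List Tile} (hg : ∀ x, g x ∈ l)
    (hm : ∀ n m : ℕ, Tile.right (g (n, m)) = Tile.left (g (n + 1, m)) ∧
      Tile.up (g (n, m)) = Tile.down (g (n, m + 1))) :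
    IsTiledGrid (quadrantModel g) l where
  exists_right _ := ⟨_, rfl⟩
  exists_up _ := ⟨_, rfl⟩
  commute := by rintro x _ _ _ _ rfl rfl rfl rfl; rfl
  exists_tile x := ⟨_, hg x, rfl⟩
  right_match := by rintro x _ rfl _ - _ - rfl rfl; exact (hm x.1 x.2).1
  up_match := by rintro x _ rfl _ - _ - rfl rfl; exact (hm x.1 x.2).2

/-- The formula reducing the tiling problem to satisfiability. -/
noncomputable def tilingFormula (l : List Tile) : Formula :=
  codingFormula [.right, .up] (tiledGrid l) top

theorem rightSymbols_subset (φ : MultiFormula Direction Tile) :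
    φ.rightSymbols ⊆ [.right, .up] := by
  rintro ⟨⟩ - <;> simp

theorem satisfiable_tilingFormula_iff {l : List Tile} :
    Satisfiable.{u} (tilingFormula l) ↔ TilesQuadrant l := by
  constructor
  · intro h
    obtain ⟨D, S, validS, x, -⟩ := exists_multiModel_of_satisfiable (rightSymbols_subset _)
      (rightSymbols_subset _) h
    exact (valid_tiledGrid_iff.1 validS).tilesQuadrant x
  · rintro ⟨g, hg, hm⟩
    exact satisfiable_codingFormula.{u} (quadrantModel g)
      (valid_tiledGrid_iff.2 (isTiledGrid_quadrantModel hg hm)) ⟨(0, 0), MultiModel.holds_top _⟩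

open Primrec in
theorem primrec_tilesMatch : Primrec₂ fun T T' : Tile => (tilesMatch T T').toFormula := by
  have primrec_noEdge (k : Direction) :
      Primrec fun p : Tile × Tile => (noEdge k p.1 p.2).toFormula :=
    primrec_imp (primrec_toFormula_prop fst)
      (primrec_toFormula_boxL k (f := fun p : Tile × Tile => .neg (.prop p.2))
        (primrec_neg (primrec_toFormula_prop snd)))
  have colors_eq (c c' : Tile → ℕ) (hc : Primrec c) (hc' : Primrec c') :
      PrimrecPred fun p : Tile × Tile => c p.1 = c' p.2 :=
    Primrec.eq.comp (hc.comp fst) (hc'.comp snd)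
  have right_eq :=
    colors_eq Tile.right Tile.left (snd.comp (snd.comp snd)) (fst.comp (snd.comp snd))
  have up_eq := colors_eq Tile.up Tile.down fst (fst.comp snd)
  exact (primrec_and (.ite right_eq (.const (top : MultiFormula Direction Tile).toFormula)
    (primrec_noEdge .right)) (.ite up_eq (.const (top : MultiFormula Direction Tile).toFormula)
    (primrec_noEdge .up))).of_eq fun p => by
      simp only [tilesMatch, toFormula, apply_ite toFormula]

theorem primrec_tilingFormula : Primrec tilingFormula := by
  have primrec_row : Primrec₂ fun (l : List Tile) T => (bigAnd l (tilesMatch T)).toFormula :=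
    primrec_toFormula_bigAnd .fst (F := fun p : List Tile × Tile => tilesMatch p.2)
      (primrec_tilesMatch.comp (Primrec.snd.comp .fst) .snd)
  exact primrec_codingFormula _ (f := tiledGrid) (primrec_and (.const _) (primrec_and
    (primrec_toFormula_bigOr .id (F := fun _ => .prop) (primrec_toFormula_prop .snd))
    (primrec_toFormula_bigAnd .id (F := fun l T => bigAnd l (tilesMatch T)) primrec_row)))
    (.const _)

theorem tilesQuadrant_manyOneReducible : ManyOneReducible TilesQuadrant Satisfiable.{u} :=
  ⟨tilingFormula, primrec_tilingFormula.to_comp, fun _ => satisfiable_tilingFormula_iff.symm⟩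

/-! ### Evaluation of partial recursive functions -/

section Programs

open Turing.ToPartrec (Code)

theorem mem_eval_cons {f g : Code} {v w : List ℕ} :
    w ∈ (Code.cons f g).eval v ↔ ∃ a ∈ f.eval v, ∃ b ∈ g.eval v, w = a.headI :: b := by
  simp

theorem mem_eval_comp {f g : Code} {v w : List ℕ} :
    w ∈ (Code.comp f g).eval v ↔ ∃ u ∈ g.eval v, w ∈ f.eval u := by
  rw [Code.comp_eval]
  exact Part.mem_bind_iff

theorem mem_eval_case {f g : Code} {v w : List ℕ} :
    w ∈ (Code.case f g).eval v ↔
      v.headI = 0 ∧ w ∈ f.eval v.tail ∨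
        v.headI ≠ 0 ∧ w ∈ g.eval ((v.headI - 1) :: v.tail) := by
  rw [Code.case_eval]
  cases h : v.headI <;> simp [h]

theorem mem_eval_fix {f : Code} {v w : List ℕ} :
    w ∈ (Code.fix f).eval v ↔
      ∃ u ∈ f.eval v, u.headI = 0 ∧ w = u.tail ∨ u.headI ≠ 0 ∧ w ∈ (Code.fix f).eval u.tail := by
  rw [Code.fix_eval]
  refine PFun.mem_fix_iff.trans ?_
  simp only [Part.mem_map_iff]
  grind

theorem eval_fix_induction {f : Code} {w : List ℕ} {C : List ℕ → Prop}
    (halt : ∀ v, ∀ u ∈ f.eval v, u.headI = 0 → w = u.tail → C v)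
    (step : ∀ v, ∀ u ∈ f.eval v, u.headI ≠ 0 → C u.tail → C v)
    {v : List ℕ} (h : w ∈ (Code.fix f).eval v) : C v := by
  rw [Code.fix_eval] at h
  refine PFun.fixInduction' h (fun v hv => ?_) fun v v' _ hv' hC => ?_
  · obtain ⟨u, hu, huw⟩ := (Part.mem_map_iff _).1 hv
    grind
  · obtain ⟨u, hu, huv'⟩ := (Part.mem_map_iff _).1 hv'
    grind

/-- Replaces the head of a list by its predecessor. -/
def decHead : Code := .cons .pred .tail

theorem decHead_eval (v : List ℕ) : decHead.eval v = pure ((v.headI - 1) :: v.tail) := by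
  simp [decHead]

/-- Forgets the meaning of the constructors, which shows that there are countably many codes. -/
def codeShape : Code → Nat.Partrec.Code
  | .zero' => .zero
  | .succ => .succ
  | .tail => .left
  | .cons f g => .pair (codeShape f) (codeShape g)
  | .comp f g => .comp (codeShape f) (codeShape g)
  | .case f g => .prec (codeShape f) (codeShape g)
  | .fix f => .rfind' (codeShape f)

theorem codeShape_injective : Function.Injective codeShape := by
  intro c d h
  induction c generalizing d <;> cases d <;> grind [codeShape]

noncomputable instance : Encodable Code := .ofInj codeShape codeShape_injective

/-- The properties of lists used in the description of a computation: having head `0` (which the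
empty list does, as `[].headI = 0`) and being empty. -/
inductive ListPred
  | zero
  | nil

noncomputable instance : Encodable ListPred :=
  .ofInj (fun p => p matches .zero) (by rintro ⟨⟩ ⟨⟩ <;> simp)

namespace MultiFormula

/-- The evaluation states are related by `k`, from the second to the first. -/
def edge {σ : Type v} {π : Type w} (k : σ) : MultiFormula σ π := diaR k .eq

/-- Under global assumption, the relation `k` is functional. -/
def functional {σ : Type v} {π : Type w} (k : σ) : MultiFormula σ π := .boxL k (.boxR k .eq)

/-- Case distinction on whether the head of the first list is zero. -/
def caseHead (φ ψ : MultiFormula Code ListPred) : MultiFormula Code ListPred :=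
  .and (imp (diaL .head (.prop .zero)) φ) (imp (diaL .head (.neg (.prop .zero))) ψ)

/-- The laws of `head`, `tail` and `decHead` that do not mention computations. -/
def listAxiom : MultiFormula Code ListPred :=
  .and (functional decHead) (.and
    (imp (.prop .nil) (.and (diaL .head (.prop .zero)) (diaL .tail (.prop .nil)))) (.and
    (.boxL .tail (diaR decHead (edge .tail)))
    (.boxL .head (.boxL decHead (diaR decHead (edge .head))))))

/-- The relation of a code contains the graph of the function it computes, provided that those of
its immediate subcodes do. The two results combined by `cons` have to be reached separately, since
a pair of states can only retain one of them; functionality brings them together. -/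
def clause : Code → MultiFormula Code ListPred
  | .zero' => diaL .zero' (.and (diaL .head (.prop .zero)) (diaL .tail .eq))
  | .succ => .boxR .head (diaL .succ (.and
      (diaL .head (.and (.neg (.prop .zero)) (diaL decHead .eq))) (diaL .tail (.prop .nil))))
  | .tail => top
  | .cons f g => .and (functional (.cons f g)) (imp (.and (diaL f top) (diaL g top)) (.and
      (.boxL f (.boxL .head (diaR (.cons f g) (edge .head))))
      (.boxL g (diaR (.cons f g) (edge .tail)))))
  | .comp f g => .boxL g (.boxL f (edge (.comp f g)))
  | .case f g => caseHead (.boxL .tail (.boxL f (edge (.case f g))))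
      (.boxL decHead (.boxL g (edge (.case f g))))
  | .fix f => .boxL f (caseHead (.boxL .tail (edge (.fix f)))
      (.boxL .tail (.boxL (.fix f) (edge (.fix f)))))

/-- The clauses of a code and of all its subcodes. -/
def clauses : Code → MultiFormula Code ListPred
  | .zero' => clause .zero'
  | .succ => clause .succ
  | .tail => clause .tail
  | .cons f g => .and (clause (.cons f g)) (.and (clauses f) (clauses g))
  | .comp f g => .and (clause (.comp f g)) (.and (clauses f) (clauses g))
  | .case f g => .and (clause (.case f g)) (.and (clauses f) (clauses g))
  | .fix f => .and (clause (.fix f)) (clauses f)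

/-- The first state stands for the list `[n]`, of which only the head is inspected. -/
def isNum : ℕ → MultiFormula Code ListPred
  | 0 => .prop .zero
  | n + 1 => .and (.neg (.prop .zero)) (diaL decHead (isNum n))

/-- The state stands for the list `[n]` and `c` has no result on it. -/
def undefinedAt (c : Code) (n : ℕ) : MultiFormula Code ListPred :=
  .and (.and (diaL .head (isNum n)) (diaL .tail (.prop .nil))) (.neg (diaL c top))

end MultiFormula

namespace MultiModel

section

variable {σ : Type v} {π : Type w} {D : Type*} {S : MultiModel σ π D} {k : σ}

@[simp]
theorem holds_edge {x y : D} : S.Holds x y (edge k) ↔ S.rel k y x := by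
  simp [edge]

theorem valid_functional : S.Valid (functional k) ↔ Relator.RightUnique (S.rel k) := by
  simp only [Valid, functional, Holds]
  exact ⟨fun h x y z hy hz => h x y hy z hz, fun h x y hy z hz => h hy hz⟩

end

variable {D : Type*} {S : MultiModel Code ListPred D}

/-- The element behaves like the list `[n]` under iteration of `decHead`. -/
def RepNum (S : MultiModel Code ListPred D) : D → ℕ → Prop
  | x, 0 => S.pred .zero x
  | x, n + 1 => ¬ S.pred .zero x ∧ ∃ y, S.rel decHead x y ∧ RepNum S y n

/-- The element behaves like the given list under `head` and `tail`. -/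
def RepList (S : MultiModel Code ListPred D) : D → List ℕ → Prop
  | x, [] => S.pred .nil x
  | x, n :: v => (∃ y, S.rel .head x y ∧ S.RepNum y n) ∧ ∃ z, S.rel .tail x z ∧ RepList S z v

theorem holds_isNum {x y : D} {n : ℕ} : S.Holds x y (isNum n) ↔ S.RepNum x n := by
  induction n generalizing x with
  | zero => rfl
  | succ n ih => simp [isNum, RepNum, ih]

theorem RepNum.eq_zero_iff {x : D} {n : ℕ} (h : S.RepNum x n) : n = 0 ↔ S.pred .zero x := by
  cases n with
  | zero => exact iff_of_true rfl h
  | succ n => exact iff_of_false n.succ_ne_zero h.1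

/-- The semantic content of `listAxiom`. -/
structure ListLaws (S : MultiModel Code ListPred D) : Prop where
  decHead_rightUnique : Relator.RightUnique (S.rel decHead)
  head_nil : ∀ ⦃x⦄, S.pred .nil x → ∃ y, S.rel .head x y ∧ S.pred .zero y
  tail_nil : ∀ ⦃x⦄, S.pred .nil x → ∃ y, S.rel .tail x y ∧ S.pred .nil y
  tail_decHead : ∀ ⦃x y⦄, S.rel .tail x y → ∃ x', S.rel decHead x x' ∧ S.rel .tail x' y
  head_decHead : ∀ ⦃x y y'⦄, S.rel .head x y → S.rel decHead y y' →
    ∃ x', S.rel decHead x x' ∧ S.rel .head x' y'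

theorem valid_listAxiom_iff : S.Valid listAxiom ↔ S.ListLaws := by
  simp only [listAxiom, valid_and, valid_functional]
  simp only [Valid, holds_imp, holds_diaL, holds_diaR, holds_edge, Holds]
  exact ⟨fun ⟨hu, hn, ht, hh⟩ => ⟨hu, fun x hx => (hn x hx).1, fun x hx => (hn x hx).2, ht,
      fun x y y' hy => hh x y hy y'⟩,
    fun h => ⟨h.decHead_rightUnique, fun x hx => ⟨h.head_nil hx, h.tail_nil hx⟩,
      fun _ _ => (h.tail_decHead ·), fun _ _ hy _ => (h.head_decHead hy ·)⟩⟩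

namespace ListLaws

variable {x : D} {v : List ℕ}

theorem repList_head (L : S.ListLaws) (hx : S.RepList x v) :
    ∃ y, S.rel .head x y ∧ S.RepNum y v.headI := by
  cases v with
  | nil => exact L.head_nil hx
  | cons n v => exact hx.1

theorem repList_tail (L : S.ListLaws) (hx : S.RepList x v) :
    ∃ y, S.rel .tail x y ∧ S.RepList y v.tail := by
  cases v with
  | nil => exact L.tail_nil hx
  | cons n v => exact hx.2

theorem repList_decHead (L : S.ListLaws) (hx : S.RepList x v) (hv : v.headI ≠ 0) :
    ∃ y, S.rel decHead x y ∧ S.RepList y ((v.headI - 1) :: v.tail) := by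
  obtain ⟨y, hxy, hy⟩ := L.repList_head hx
  obtain ⟨n, hn⟩ := Nat.exists_eq_succ_of_ne_zero hv
  rw [hn] at hy ⊢
  obtain ⟨-, y', hyy', hy'⟩ := hy
  obtain ⟨z, hxz, hz⟩ := L.repList_tail hx
  obtain ⟨x', hxx', hx'z⟩ := L.tail_decHead hxz
  obtain ⟨x'', hxx'', hx''y'⟩ := L.head_decHead hxy hyy'
  obtain rfl := L.decHead_rightUnique hxx' hxx''
  exact ⟨x', hxx', ⟨y', hx''y', hy'⟩, z, hx'z, hz⟩

theorem of_holds_caseHead {y : D} {φ ψ : MultiFormula Code ListPred} (L : S.ListLaws)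
    (hx : S.RepList x v) (h : S.Holds x y (caseHead φ ψ)) :
    (v.headI = 0 → S.Holds x y φ) ∧ (v.headI ≠ 0 → S.Holds x y ψ) := by
  obtain ⟨z, hxz, hz⟩ := L.repList_head hx
  simp only [caseHead, Holds, holds_imp, holds_diaL] at h
  exact ⟨fun hv => h.1 ⟨z, hxz, hz.eq_zero_iff.1 hv⟩,
    fun hv => h.2 ⟨z, hxz, mt hz.eq_zero_iff.2 hv⟩⟩

end ListLaws

/-- On elements standing for lists, the relation `c` contains the graph of the partial function
computed by `c`. -/
def Computes (S : MultiModel Code ListPred D) (c : Code) : Prop :=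
  ∀ ⦃x v w⦄, S.RepList x v → w ∈ c.eval v → ∃ y, S.rel c x y ∧ S.RepList y w

variable {f g : Code}

theorem computes_zero' (h : S.Valid (clause .zero')) : S.Computes .zero' := by
  intro x v w hx hw
  obtain rfl : w = 0 :: v := by simpa using hw
  simp only [Valid, clause, holds_diaL, Holds] at h
  obtain ⟨y, hxy, hy, _, hyx, rfl⟩ := h x
  exact ⟨y, hxy, hy, _, hyx, hx⟩

theorem computes_succ (L : S.ListLaws) (h : S.Valid (clause .succ)) : S.Computes .succ := by
  intro x v w hx hw
  obtain rfl : w = [v.headI + 1] := by simpa using hw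
  simp only [Valid, clause, holds_diaL, Holds] at h
  obtain ⟨m, hxm, hm⟩ := L.repList_head hx
  obtain ⟨y, hxy, ⟨n, hyn, hn, _, hnm, rfl⟩, z, hyz, hz⟩ := h x m hxm
  exact ⟨y, hxy, ⟨n, hyn, hn, _, hnm, hm⟩, z, hyz, hz⟩

theorem computes_tail (L : S.ListLaws) : S.Computes .tail := by
  intro x v w hx hw
  obtain rfl : w = v.tail := by simpa using hw
  exact L.repList_tail hx

theorem computes_cons (L : S.ListLaws) (h : S.Valid (clause (.cons f g))) (hf : S.Computes f)
    (hg : S.Computes g) : S.Computes (.cons f g) := by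
  intro x v w hx hw
  obtain ⟨a, ha, b, hb, rfl⟩ := mem_eval_cons.1 hw
  rw [clause, valid_and, valid_functional] at h
  obtain ⟨unique, h⟩ := h
  simp only [Valid, holds_imp, holds_diaL, holds_diaR, holds_edge, holds_top, Holds,
    and_true] at h
  obtain ⟨y, hxy, hy⟩ := hf hx ha
  obtain ⟨z, hxz, hz⟩ := hg hx hb
  obtain ⟨n, hyn, hn⟩ := L.repList_head hy
  obtain ⟨head_of_f, tail_of_g⟩ := h x ⟨⟨y, hxy⟩, z, hxz⟩
  obtain ⟨r, hxr, hrn⟩ := head_of_f y hxy n hyn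
  obtain ⟨r', hxr', hr'z⟩ := tail_of_g z hxz
  obtain rfl := unique hxr hxr'
  exact ⟨r, hxr, ⟨n, hrn, hn⟩, z, hr'z, hz⟩

theorem computes_comp (h : S.Valid (clause (.comp f g))) (hf : S.Computes f)
    (hg : S.Computes g) : S.Computes (.comp f g) := by
  intro x v w hx hw
  obtain ⟨u, hu, hw⟩ := mem_eval_comp.1 hw
  simp only [Valid, clause, holds_edge, Holds] at h
  obtain ⟨y, hxy, hy⟩ := hg hx hu
  obtain ⟨z, hyz, hz⟩ := hf hy hw
  exact ⟨z, h x y hxy z hyz, hz⟩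

theorem computes_case (L : S.ListLaws) (h : S.Valid (clause (.case f g))) (hf : S.Computes f)
    (hg : S.Computes g) : S.Computes (.case f g) := by
  intro x v w hx hw
  obtain ⟨zero_case, pos_case⟩ := L.of_holds_caseHead hx (h x)
  simp only [holds_edge, Holds] at zero_case pos_case
  obtain ⟨hv, hw⟩ | ⟨hv, hw⟩ := mem_eval_case.1 hw
  · obtain ⟨y, hxy, hy⟩ := L.repList_tail hx
    obtain ⟨z, hyz, hz⟩ := hf hy hw
    exact ⟨z, zero_case hv y hxy z hyz, hz⟩
  · obtain ⟨y, hxy, hy⟩ := L.repList_decHead hx hv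
    obtain ⟨z, hyz, hz⟩ := hg hy hw
    exact ⟨z, pos_case hv y hxy z hyz, hz⟩

theorem computes_fix (L : S.ListLaws) (h : S.Valid (clause (.fix f))) (hf : S.Computes f) :
    S.Computes (.fix f) := by
  intro x v w hx hw
  have tail_of_f {x : D} {v u : List ℕ} (hx : S.RepList x v) (hu : u ∈ f.eval v) :
      ∃ z, S.RepList z u.tail ∧ (u.headI = 0 → S.rel (.fix f) x z) ∧
        (u.headI ≠ 0 → ∀ y, S.rel (.fix f) z y → S.rel (.fix f) x y) := by
    obtain ⟨y, hxy, hy⟩ := hf hx hu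
    obtain ⟨z, hyz, hz⟩ := L.repList_tail hy
    obtain ⟨halt, step⟩ := L.of_holds_caseHead hy (h x y hxy)
    simp only [holds_edge, Holds] at halt step
    exact ⟨z, hz, fun hu => halt hu z hyz, fun hu => step hu z hyz⟩
  refine eval_fix_induction (C := fun v => ∀ x, S.RepList x v →
    ∃ y, S.rel (.fix f) x y ∧ S.RepList y w) ?_ ?_ hw x hx
  · rintro v u hu hu0 rfl x hx
    obtain ⟨z, hz, halt, -⟩ := tail_of_f hx hu
    exact ⟨z, halt hu0, hz⟩
  · intro v u hu hu0 ih x hx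
    obtain ⟨z, hz, -, step⟩ := tail_of_f hx hu
    obtain ⟨y, hzy, hy⟩ := ih z hz
    exact ⟨y, step hu0 y hzy, hy⟩

theorem computes_of_valid (L : S.ListLaws) {c : Code} (h : S.Valid (clauses c)) :
    S.Computes c := by
  induction c with
  | zero' => exact computes_zero' h
  | succ => exact computes_succ L h
  | tail => exact computes_tail L
  | fix f ih =>
    obtain ⟨h, hf⟩ := S.valid_and.1 h
    exact computes_fix L h (ih hf)
  | cons f g ihf ihg =>
    obtain ⟨h, hfg⟩ := S.valid_and.1 h
    obtain ⟨hf, hg⟩ := S.valid_and.1 hfg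
    exact computes_cons L h (ihf hf) (ihg hg)
  | comp f g ihf ihg =>
    obtain ⟨h, hfg⟩ := S.valid_and.1 h
    obtain ⟨hf, hg⟩ := S.valid_and.1 hfg
    exact computes_comp h (ihf hf) (ihg hg)
  | case f g ihf ihg =>
    obtain ⟨h, hfg⟩ := S.valid_and.1 h
    obtain ⟨hf, hg⟩ := S.valid_and.1 hfg
    exact computes_case L h (ihf hf) (ihg hg)

end MultiModel

open MultiModel

/-- The lists themselves, each code being interpreted by the graph of the function it computes. -/
def evalModel : MultiModel Code ListPred (List ℕ) where
  rel c v w := w ∈ c.eval v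
  pred
    | .zero, v => v.headI = 0
    | .nil, v => v = []

section EvalModel

variable {u v w : List ℕ} {c : Code} {n : ℕ}

theorem evalModel_rel : evalModel.rel c v w ↔ w ∈ c.eval v := Iff.rfl

theorem evalModel_rel_head : evalModel.rel .head v w ↔ w = [v.headI] := by
  simp [evalModel_rel]

theorem evalModel_rel_tail : evalModel.rel .tail v w ↔ w = v.tail := by
  simp [evalModel_rel]

theorem evalModel_rel_decHead : evalModel.rel decHead v w ↔ w = (v.headI - 1) :: v.tail := by
  simp [evalModel_rel, decHead_eval]

theorem evalModel_pred_zero : evalModel.pred .zero v ↔ v.headI = 0 := Iff.rfl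

theorem evalModel_pred_nil : evalModel.pred .nil v ↔ v = [] := Iff.rfl

theorem evalModel_rightUnique : Relator.RightUnique (evalModel.rel c) :=
  fun _ _ _ => Part.mem_unique

theorem listLaws_evalModel : evalModel.ListLaws where
  decHead_rightUnique := evalModel_rightUnique
  head_nil := by simp [evalModel_rel_head, evalModel_pred_zero, evalModel_pred_nil]
  tail_nil := by simp [evalModel_rel_tail, evalModel_pred_nil]
  tail_decHead := by simp [evalModel_rel_tail, evalModel_rel_decHead]
  head_decHead := by simp [evalModel_rel_head, evalModel_rel_decHead]

theorem evalModel_holds_caseHead {φ ψ : MultiFormula Code ListPred} :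
    evalModel.Holds v w (caseHead φ ψ) ↔
      (v.headI = 0 → evalModel.Holds v w φ) ∧
        (v.headI ≠ 0 → evalModel.Holds v w ψ) := by
  simp [caseHead, evalModel_rel_head, evalModel_pred_zero]

theorem valid_clause_cons_evalModel {f g : Code} : evalModel.Valid (clause (.cons f g)) := by
  refine evalModel.valid_and.2 ⟨valid_functional.2 evalModel_rightUnique, fun v => ?_⟩
  simp only [MultiModel.holds_imp, holds_diaL, holds_diaR, holds_edge, holds_top,
    MultiModel.Holds, and_true, evalModel_rel_head, evalModel_rel_tail, forall_eq]
  rintro ⟨⟨a, ha⟩, b, hb⟩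
  have result {a b : List ℕ} (ha : evalModel.rel f v a) (hb : evalModel.rel g v b) :
      evalModel.rel (.cons f g) v (a.headI :: b) := mem_eval_cons.2 ⟨a, ha, b, hb, rfl⟩
  exact ⟨fun a' ha' => ⟨_, result ha' hb, rfl⟩, fun b' hb' => ⟨_, result ha hb', rfl⟩⟩

theorem valid_clause_evalModel (c : Code) : evalModel.Valid (clause c) := by
  intro v
  cases c with
  | zero' =>
    refine (holds_diaL _).2 ⟨0 :: v, by simp [evalModel_rel], ?_⟩
    simp [evalModel_rel_head, evalModel_rel_tail, evalModel_pred_zero]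
  | succ =>
    rintro _ h
    obtain rfl := evalModel_rel_head.1 h
    refine (holds_diaL _).2 ⟨[v.headI + 1], by simp [evalModel_rel], ?_⟩
    simp [evalModel_rel_head, evalModel_rel_tail, evalModel_rel_decHead, evalModel_pred_zero,
      evalModel_pred_nil]
  | tail => exact holds_top _
  | cons f g => exact valid_clause_cons_evalModel v
  | comp f g =>
    intro u hu w hw
    exact holds_edge.2 (mem_eval_comp.2 ⟨u, hu, hw⟩)
  | case f g =>
    simp only [clause, evalModel_holds_caseHead, MultiModel.Holds, holds_edge, evalModel_rel_tail,
      evalModel_rel_decHead, forall_eq]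
    exact ⟨fun hv w hw => mem_eval_case.2 (.inl ⟨hv, hw⟩),
      fun hv w hw => mem_eval_case.2 (.inr ⟨hv, hw⟩)⟩
  | fix f =>
    simp only [clause, evalModel_holds_caseHead, MultiModel.Holds, holds_edge,
      evalModel_rel_tail, forall_eq]
    exact fun u hu => ⟨fun hu0 => mem_eval_fix.2 ⟨u, hu, .inl ⟨hu0, rfl⟩⟩,
      fun hu0 w hw => mem_eval_fix.2 ⟨u, hu, .inr ⟨hu0, hw⟩⟩⟩

theorem valid_clauses_evalModel (c : Code) : evalModel.Valid (clauses c) := by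
  induction c with
  | zero' | succ | tail => exact valid_clause_evalModel _
  | fix f ih => exact evalModel.valid_and.2 ⟨valid_clause_evalModel _, ih⟩
  | cons f g ihf ihg | comp f g ihf ihg | case f g ihf ihg =>
    exact evalModel.valid_and.2 ⟨valid_clause_evalModel _, evalModel.valid_and.2 ⟨ihf, ihg⟩⟩

theorem repNum_evalModel (hv : v.headI = n) : evalModel.RepNum v n := by
  induction n generalizing v with
  | zero => exact hv
  | succ n ih =>
    exact ⟨by simp [evalModel_pred_zero, hv], _, evalModel_rel_decHead.2 rfl, ih (by simp [hv])⟩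

theorem evalModel_holds_undefinedAt :
    evalModel.Holds [n] w (undefinedAt c n) ↔ ¬ (c.eval [n]).Dom := by
  have repNum : evalModel.RepNum [n] n := repNum_evalModel rfl
  simp [undefinedAt, holds_isNum, evalModel_pred_nil, repNum, evalModel_rel, Part.dom_iff_mem]

end EvalModel

theorem not_dom_of_holds_undefinedAt {D : Type*} {S : MultiModel Code ListPred D} {c : Code}
    {n : ℕ} (hc : S.Computes c) {x y : D} (h : S.Holds x y (undefinedAt c n)) :
    ¬ (c.eval [n]).Dom := by
  simp only [undefinedAt, MultiModel.Holds, holds_diaL, holds_isNum, holds_top, and_true] at h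
  obtain ⟨repList, undefined⟩ := h
  intro hdom
  obtain ⟨w, hw⟩ := Part.dom_iff_mem.1 hdom
  obtain ⟨y, hxy, -⟩ := hc (v := [n]) repList hw
  exact undefined ⟨y, hxy⟩

theorem rightSymbols_undefinedAt (c : Code) (n : ℕ) : (undefinedAt c n).rightSymbols = [] := by
  have rightSymbols_isNum : (isNum n).rightSymbols = [] := by
    induction n with
    | zero => rfl
    | succ _ ih => exact ih
  simp [undefinedAt, rightSymbols, diaL, top, imp, rightSymbols_isNum]

/-- The assumption describing the computations of `c`. -/
def program (c : Code) : MultiFormula Code ListPred := .and listAxiom (clauses c)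

/-- The formula reducing the divergence of `c` to satisfiability. -/
noncomputable def divergenceFormula (c : Code) (n : ℕ) : Formula :=
  codingFormula (program c).rightSymbols (program c) (undefinedAt c n)

theorem satisfiable_divergenceFormula_iff {c : Code} {n : ℕ} :
    Satisfiable.{u} (divergenceFormula c n) ↔ ¬ (c.eval [n]).Dom := by
  constructor
  · intro h
    obtain ⟨D, S, validS, x, hx⟩ := exists_multiModel_of_satisfiable (List.Subset.refl _)
      (by simp [rightSymbols_undefinedAt]) h
    obtain ⟨laws, clausesS⟩ := S.valid_and.1 validS
    exact not_dom_of_holds_undefinedAt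
      (computes_of_valid (valid_listAxiom_iff.1 laws) clausesS) hx
  · intro h
    have valid_program : evalModel.Valid (program c) :=
      evalModel.valid_and.2 ⟨valid_listAxiom_iff.2 listLaws_evalModel, valid_clauses_evalModel c⟩
    exact satisfiable_codingFormula.{u} evalModel valid_program
      ⟨[n], evalModel_holds_undefinedAt.2 h⟩

theorem primrec_toFormula_isNum : Primrec fun n => (isNum n).toFormula :=
  (Primrec.nat_rec₁
    (f := fun _ φ => .and (.neg (.pl (encode ListPred.zero)))
      (.neg (.box (.imp (.pl (encode decHead)) (.box (.neg φ))))))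
    (.pl (encode ListPred.zero))
    (primrec_and (.const _) (primrec_neg (primrec_box (primrec_imp (.const _)
      (primrec_box (primrec_neg Primrec.snd)))))).to₂).of_eq fun n => by
    induction n with
    | zero => rfl
    | succ n ih => simp [isNum, diaL, toFormula, ← ih]

theorem primrec_divergenceFormula (c : Code) : Primrec (divergenceFormula c) :=
  primrec_codingFormula _ (f := fun _ => program c) (.const _) (primrec_and (primrec_and
    (primrec_toFormula_diaL _ primrec_toFormula_isNum) (.const _)) (.const _))

theorem exists_code_of_rePred {A : Type*} [Primcodable A] {p : A → Prop} (hp : REPred p) :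
    ∃ c : Code, ∀ a, (c.eval [encode a]).Dom ↔ p a := by
  obtain ⟨c, hc⟩ := Code.exists_code (Nat.Partrec'.part_iff₁.2 (Partrec.nat_iff.2 hp))
  refine ⟨c, fun a => ?_⟩
  have eval_encode := hc (encode a ::ᵥ .nil)
  change c.eval [encode a] = _ at eval_encode
  simp only [eval_encode, List.Vector.head_cons, Encodable.encodek, Part.coe_some, Part.bind_some]
  exact ⟨fun ⟨ha, _⟩ => ha, fun ha => ⟨ha, trivial⟩⟩

theorem compl_manyOneReducible_satisfiable {A : Type*} [Primcodable A] {p : A → Prop}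
    (hp : REPred p) : ManyOneReducible (fun a => ¬ p a) Satisfiable.{u} := by
  obtain ⟨c, hc⟩ := exists_code_of_rePred hp
  exact ⟨fun a => divergenceFormula c (encode a),
    ((primrec_divergenceFormula c).comp Primrec.encode).to_comp,
    fun a => (not_congr (hc a)).symm.trans satisfiable_divergenceFormula_iff.symm⟩

theorem not_computablePred_satisfiable : ¬ ComputablePred Satisfiable.{u} := by
  intro h
  have computable_divergence :=
    ComputablePred.computable_of_manyOneReducible
      (compl_manyOneReducible_satisfiable (ComputablePred.halting_problem_re 0)) h
  exact ComputablePred.halting_problem 0 (computable_divergence.not.of_eq fun _ => not_not)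

end Programs

end LHS

theorem mainTheorem1 :
    ¬ ComputablePred LHS.Satisfiable.{u} ∧
      ManyOneReducible LHS.TilesQuadrant LHS.Satisfiable.{u} :=
  ⟨LHS.not_computablePred_satisfiable, LHS.tilesQuadrant_manyOneReducible⟩
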